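/- Let $\theta\in\mathbb{R}$ be irrational and let $(e_n)_{n\in\mathbb{Z}}$ be the standard basis of $\ell^2(\mathbb{Z})$. Put $x_n=2\cos(2\pi n\theta)+3$ for $n\in\mathbb{Z}$, and let $T_x$, $T$, $D$ be the bounded operators on $\ell^2(\mathbb{Z})$ with $T_xe_n=x_ne_{n+1}$, $Te_n=e_{n+1}$ and $De_n=e^{2\pi i n\theta}e_n$. For a set $S$ of bounded operators, let $C^*(S)$ be the norm-closed $*$-subalgebra of $B(\ell^2(\mathbb{Z}))$ generated by $S$ and $1$, and write $A_x=C^*(T_x)$. Let $A_\theta$ be the irrational rotation algebra, that is, the universal unital $C^*$-algebra generated by two unitaries $u,v$ subject to $uv=e^{2\pi i\theta}vu$. Then $$A_x=C^*(T_x)=C^*(T,D)$$ as subalgebras of $B(\ell^2(\mathbb{Z}))$, and there is a $*$-isomorphism $A_\theta\to A_x$ that maps $u$ to $D$ and $v$ to $T$. In particular $A_x\cong A_\theta$. -/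

import Mathlib

open scoped ENNReal

universe w

noncomputable section

namespace WeightedShiftAlgebra

/-! ### Weighted shifts and diagonal operators on the space of square summable sequences -/

/-- The Hilbert space `ℓ²(ℤ)`. -/
abbrev L2Z : Type := lp (fun _ : ℤ => ℂ) 2

/-- Bounded complex sequences indexed by `ℤ`. -/
abbrev BddSeq : Type := lp (fun _ : ℤ => ℂ) ∞

/-- The standard basis vector `e_n` of `ℓ²(ℤ)`. -/
def e (n : ℤ) : L2Z := lp.single 2 n (1 : ℂ)

lemma memlp_mul (a : BddSeq) (f : L2Z) (σ : ℤ ≃ ℤ) :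
    Memℓp (fun n => a n * f (σ n) : ∀ _ : ℤ, ℂ) 2 ∧
      ∑' n, ‖a n * f (σ n)‖ ^ (2 : ℝ≥0∞).toReal ≤ (‖a‖ * ‖f‖) ^ (2 : ℝ≥0∞).toReal := by
  have h2 : 0 < (2 : ℝ≥0∞).toReal := by norm_num
  have hs : Summable fun n => ‖f (σ n)‖ ^ (2 : ℝ≥0∞).toReal :=
    (σ.summable_iff (f := fun n => ‖f n‖ ^ (2 : ℝ≥0∞).toReal)).2 ((lp.memℓp f).summable h2)
  have hle : ∀ n, ‖a n * f (σ n)‖ ^ (2 : ℝ≥0∞).toReal ≤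
      ‖a‖ ^ (2 : ℝ≥0∞).toReal * ‖f (σ n)‖ ^ (2 : ℝ≥0∞).toReal := fun n => by
    rw [norm_mul, ← Real.mul_rpow (norm_nonneg _) (norm_nonneg _)]
    have := lp.norm_apply_le_norm ENNReal.top_ne_zero a n
    gcongr
  have hs' := hs.mul_left (‖a‖ ^ (2 : ℝ≥0∞).toReal)
  have hs'' := Summable.of_nonneg_of_le (fun n => by positivity) hle hs'
  refine ⟨memℓp_gen hs'', (hs''.tsum_le_tsum hle hs').trans ?_⟩
  rw [tsum_mul_left, Real.mul_rpow (norm_nonneg _) (norm_nonneg _), lp.norm_rpow_eq_tsum h2 f,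
    σ.tsum_eq (fun n => ‖f n‖ ^ (2 : ℝ≥0∞).toReal)]

/-- For a bounded sequence `a` and a bijection `σ` of `ℤ`, the bounded operator on `ℓ²(ℤ)`
given by `(W f) n = a n * f (σ n)`. -/
def weightedPerm (a : BddSeq) (σ : ℤ ≃ ℤ) : L2Z →L[ℂ] L2Z :=
  LinearMap.mkContinuous
    { toFun := fun f => (⟨fun n => a n * f (σ n), (memlp_mul a f σ).1⟩ : L2Z)
      map_add' := fun f g => by
        ext n
        exact mul_add _ _ _
      map_smul' := fun c f => by
        ext n
        simp [mul_left_comm] }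
    ‖a‖ (fun f => lp.norm_le_of_tsum_le (by norm_num) (by positivity) (memlp_mul a f σ).2)

@[simp] lemma weightedPerm_apply (a : BddSeq) (σ : ℤ ≃ ℤ) (f : L2Z) (n : ℤ) :
    weightedPerm a σ f n = a n * f (σ n) := rfl

/-- The diagonal operator `e_n ↦ a_n e_n`. -/
def diagonal (a : BddSeq) : L2Z →L[ℂ] L2Z := weightedPerm a (Equiv.refl ℤ)

/-- The bilateral shift `T`, `T e_n = e_{n+1}`. -/
def shift : L2Z →L[ℂ] L2Z := weightedPerm 1 (Equiv.subRight 1)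

/-- The weighted shift `T_x`, `T_x e_n = x_n e_{n+1}`. -/
def weightedShift (x : BddSeq) : L2Z →L[ℂ] L2Z := shift ∘L diagonal x

lemma diagonal_e (a : BddSeq) (n : ℤ) : diagonal a (e n) = a n • e n := by
  ext m
  by_cases h : m = n
  · subst h; simp [diagonal, e]
  · simp [diagonal, e, h]

lemma shift_e (n : ℤ) : shift (e n) = e (n + 1) := by
  ext m
  by_cases h : m = n + 1
  · subst h; simp [shift, e, lp.infty_coeFn_one]
  · have h' : m - 1 ≠ n := fun h'' => h (by omega)
    simp [shift, e, lp.infty_coeFn_one, h, h']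

lemma weightedShift_e (x : BddSeq) (n : ℤ) : weightedShift x (e n) = x n • e (n + 1) := by
  simp [weightedShift, diagonal_e, shift_e]

/-- The weights `x_n = 2 cos(2 π n θ) + 3`. -/
def cosWeight (θ : ℝ) : BddSeq :=
  ⟨fun n => ((2 * Real.cos (2 * Real.pi * n * θ) + 3 : ℝ) : ℂ), memℓp_infty ⟨5, by
    rintro _ ⟨n, rfl⟩
    have h1 := Real.cos_le_one (2 * Real.pi * n * θ)
    have h2 := Real.neg_one_le_cos (2 * Real.pi * n * θ)
    simp only [Complex.norm_real, Real.norm_eq_abs]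
    exact abs_le.2 ⟨by linarith, by linarith⟩⟩⟩

/-- The sequence `n ↦ e^{2 π i n θ}`. -/
def phase (θ : ℝ) : BddSeq :=
  ⟨fun n => Complex.exp (2 * Real.pi * Complex.I * n * θ), memℓp_infty ⟨1, by
    rintro _ ⟨n, rfl⟩
    have h : (2 * Real.pi * Complex.I * n * θ : ℂ) =
        ((2 * Real.pi * n * θ : ℝ) : ℂ) * Complex.I := by
      push_cast; ring
    simp only [h, Complex.norm_exp_ofReal_mul_I, le_refl]⟩⟩

/-- The (unital) C⋆-algebra `C⋆(S)` generated by `1` and a set `S` of elements of a unital normed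
⋆-algebra. -/
def cstarGen {A : Type*} [NormedRing A] [NormedAlgebra ℂ A] [StarRing A] [StarModule ℂ A]
    [ContinuousStar A] (S : Set A) : StarSubalgebra ℂ A :=
  (StarAlgebra.adjoin ℂ S).topologicalClosure

/-! ### The rotation algebra: the universal C⋆-algebra generated by two unitaries `u`, `v` with
`u v = e^{2πiθ} v u` -/

/-- A nonzero unital C⋆-algebra with two unitaries satisfying the rotation relation. -/
structure RotationPair (θ : ℝ) : Type (w + 1) where
  carrier : Type w
  [cstar : CStarAlgebra carrier]
  [nontriv : Nontrivial carrier]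
  u : carrier
  v : carrier
  u_mem : u ∈ unitary carrier
  v_mem : v ∈ unitary carrier
  rel : u * v = Complex.exp (2 * Real.pi * Complex.I * θ) • (v * u)

attribute [instance] RotationPair.cstar RotationPair.nontriv

/-- The `ℓ^∞`-product of all nonzero C⋆-algebras (in a fixed universe) that carry a pair of
unitaries satisfying the rotation relation, one factor for each such pair. -/
abbrev RotationProduct (θ : ℝ) : Type (w + 1) :=
  lp (fun ρ : RotationPair.{w} θ => ρ.carrier) ∞

/-- The family of all first unitaries. -/
def prodU (θ : ℝ) : RotationProduct.{w} θ :=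
  ⟨fun ρ => ρ.u, memℓp_infty ⟨1, by
    rintro _ ⟨ρ, rfl⟩
    exact (CStarRing.norm_of_mem_unitary ρ.u_mem).le⟩⟩

/-- The family of all second unitaries. -/
def prodV (θ : ℝ) : RotationProduct.{w} θ :=
  ⟨fun ρ => ρ.v, memℓp_infty ⟨1, by
    rintro _ ⟨ρ, rfl⟩
    exact (CStarRing.norm_of_mem_unitary ρ.v_mem).le⟩⟩

/-- The rotation algebra `A_θ = ⟨u, v | u v = e^{2πiθ} v u, u and v unitary⟩`: the C⋆-algebra
generated by the universal pair inside the product of all pairs. Its universal property is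
proved in `existsUnique_lift`. -/
def rotationAlgebra (θ : ℝ) : StarSubalgebra ℂ (RotationProduct.{w} θ) :=
  cstarGen {prodU θ, prodV θ}

instance isClosed_rotationAlgebra (θ : ℝ) :
    IsClosed (rotationAlgebra.{w} θ : Set (RotationProduct.{w} θ)) :=
  StarSubalgebra.isClosed_topologicalClosure _

lemma prodU_mem (θ : ℝ) : prodU.{w} θ ∈ rotationAlgebra.{w} θ :=
  StarSubalgebra.le_topologicalClosure _ (StarAlgebra.subset_adjoin ℂ _ (by simp))

lemma prodV_mem (θ : ℝ) : prodV.{w} θ ∈ rotationAlgebra.{w} θ :=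
  StarSubalgebra.le_topologicalClosure _ (StarAlgebra.subset_adjoin ℂ _ (by simp))

/-- The generator `u` of `A_θ`. -/
def rotU (θ : ℝ) : rotationAlgebra.{w} θ := ⟨prodU θ, prodU_mem θ⟩

/-- The generator `v` of `A_θ`. -/
def rotV (θ : ℝ) : rotationAlgebra.{w} θ := ⟨prodV θ, prodV_mem θ⟩

instance (θ : ℝ) : CStarAlgebra (RotationProduct.{w} θ) where

instance (θ : ℝ) : CStarAlgebra (rotationAlgebra.{w} θ) := inferInstance

lemma rotU_mem_unitary (θ : ℝ) : rotU.{w} θ ∈ unitary (rotationAlgebra.{w} θ) := by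
  constructor <;> (ext ρ; first | exact ρ.u_mem.1 | exact ρ.u_mem.2)

lemma rotV_mem_unitary (θ : ℝ) : rotV.{w} θ ∈ unitary (rotationAlgebra.{w} θ) := by
  constructor <;> (ext ρ; first | exact ρ.v_mem.1 | exact ρ.v_mem.2)

lemma rot_rel (θ : ℝ) : rotU.{w} θ * rotV θ =
    Complex.exp (2 * Real.pi * Complex.I * θ) • (rotV θ * rotU θ) := by
  ext ρ
  exact ρ.rel

/-- Evaluation at a factor. -/
def evalHom {θ : ℝ} (ρ : RotationPair.{w} θ) : rotationAlgebra.{w} θ →⋆ₐ[ℂ] ρ.carrier where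
  toFun a := (a : RotationProduct.{w} θ) ρ
  map_one' := rfl
  map_mul' _ _ := rfl
  map_zero' := rfl
  map_add' _ _ := rfl
  commutes' _ := rfl
  map_star' _ := rfl

open scoped CStarAlgebra in
/-- Universal property of `A_θ`. -/
theorem existsUnique_lift (θ : ℝ) {B : Type w} [CStarAlgebra B] (a b : B)
    (ha : a ∈ unitary B) (hb : b ∈ unitary B)
    (h : a * b = Complex.exp (2 * Real.pi * Complex.I * θ) • (b * a)) :
    ∃! φ : rotationAlgebra.{w} θ →⋆ₐ[ℂ] B, φ (rotU θ) = a ∧ φ (rotV θ) = b := by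
  refine existsUnique_of_exists_of_unique ?_ ?_
  · rcases subsingleton_or_nontrivial B with hB | hB
    · exact ⟨{ toFun := fun _ => 0
               map_one' := Subsingleton.elim _ _
               map_mul' := fun _ _ => Subsingleton.elim _ _
               map_zero' := Subsingleton.elim _ _
               map_add' := fun _ _ => Subsingleton.elim _ _
               commutes' := fun _ => Subsingleton.elim _ _
               map_star' := fun _ => Subsingleton.elim _ _ },
        Subsingleton.elim _ _, Subsingleton.elim _ _⟩
    · exact ⟨evalHom ⟨B, a, b, ha, hb, h⟩, rfl, rfl⟩
  · intro φ ψ hφ hψ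
    have hc : ∀ χ : rotationAlgebra.{w} θ →⋆ₐ[ℂ] B, Continuous χ := fun χ => map_continuous χ
    refine StarAlgHom.ext_topologicalClosure (hc φ) (hc ψ) ?_
    refine StarAlgHom.ext_adjoin ?_
    rintro ⟨x, hx⟩ (rfl | rfl)
    · exact hφ.1.trans hψ.1.symm
    · exact hφ.2.trans hψ.2.symm

end WeightedShiftAlgebra

end

noncomputable section

namespace WeightedShiftAlgebra

open Filter Topology

/-! ### Powers of a complex number of modulus one -/

/-! Write `p = phase θ` and `ζ = e^{2πiθ}`. Since `x = p + p̄ + 3`, the operator `T_x = T · diag(x)`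
lies in `C⋆(T, D)`. Conversely `T_x⋆ T_x = diag(x²)`, and `x ≥ 1`, so `C⋆(T_x)` contains `diag(x)`,
its inverse, and hence `T`. Conjugation by `T` turns `p + p̄` into `ζp + ζ̄p̄`; as `ζ ≠ ζ̄`, these
two sequences determine `p` linearly (`le_cstarGen_weightedShift`).

The universal property gives a ⋆-homomorphism from `A_θ` onto `C⋆(T, D)`, so what remains is its
injectivity, that is, simplicity of `A_θ` (`injective_of_dense`). The automorphisms `Ad u` and `Ad
v` commute and scale each monomial `u^m v^n` by powers of `ζ`, so averages over squares in `ℤ²`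
converge to scalars on the span of the monomials.

Almost periodicity of the orbits takes the place of a faithful trace (`ErgodicFamily.injective`). If
`b ≥ 0` lies in the kernel, a finite sum `b'` of translates of `b` has the property that each of its
translates dominates an element close to `b`. Hence the averages of `b'` have norm at least about
`‖b‖`. They also lie in the kernel and come close to a scalar, which must then be small, so `b = 0`.
-/

lemma tendsto_mean_pow {z : ℂ} (hz : ‖z‖ = 1) :
    Tendsto (fun N : ℕ => (N : ℂ)⁻¹ * ∑ j ∈ Finset.range N, z ^ j) atTop
      (𝓝 (if z = 1 then 1 else 0)) := by
  split_ifs with h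
  · subst h
    refine tendsto_const_nhds.congr' ?_
    filter_upwards [eventually_ne_atTop 0] with N hN
    simp [hN]
  · refine tendsto_inv_atTop_nhds_zero_nat.zero_mul_isBoundedUnder_le ⟨2 / ‖z - 1‖, ?_⟩
    refine eventually_map.2 (Eventually.of_forall fun N => ?_)
    simp only [Function.comp_apply]
    rw [geom_sum_eq h, norm_div]
    gcongr
    calc ‖z ^ N - 1‖ ≤ ‖z ^ N‖ + ‖(1 : ℂ)‖ := norm_sub_le _ _
      _ = 2 := by rw [norm_pow, hz]; norm_num

/-- Almost periodicity: the unit circle is compact, so finitely many powers of `z` form a `δ`-net of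
all of them, and dividing by a power of `z` preserves distances. -/
lemma exists_finset_zpow_approx {z : ℂ} (hz : ‖z‖ = 1) {δ : ℝ} (hδ : 0 < δ) :
    ∃ F : Finset ℤ, ∀ j : ℤ, ∃ i ∈ F, ‖z ^ (j - i) - 1‖ < δ := by
  have hz0 : z ≠ 0 := fun h => by simp [h] at hz
  have htb : TotallyBounded (Set.range fun j : ℤ => z ^ j) := by
    refine (isCompact_sphere (0 : ℂ) 1).totallyBounded.subset ?_
    rintro _ ⟨j, rfl⟩
    simp [norm_zpow, hz]
  obtain ⟨t, hts, htf, ht⟩ := Metric.finite_approx_of_totallyBounded htb δ hδ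
  have hg : ∀ y : ℂ, ∃ i : ℤ, y ∈ t → z ^ i = y := fun y => by
    by_cases hy : y ∈ t
    · obtain ⟨i, hi⟩ := hts hy
      exact ⟨i, fun _ => hi⟩
    · exact ⟨0, fun h => absurd h hy⟩
  choose g hg using hg
  refine ⟨htf.toFinset.image g, fun j => ?_⟩
  obtain ⟨y, hy, hjy⟩ := Set.mem_iUnion₂.1 (ht ⟨j, rfl⟩)
  refine ⟨g y, Finset.mem_image_of_mem _ (htf.mem_toFinset.2 hy), ?_⟩
  have hne : z ^ g y ≠ 0 := zpow_ne_zero _ hz0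
  have hdiv : z ^ (j - g y) - 1 = (z ^ j - z ^ g y) / z ^ g y := by
    rw [zpow_sub₀ hz0, sub_div, div_self hne]
  rw [hdiv, norm_div, norm_zpow, hz, one_zpow, div_one, hg y hy]
  simpa [dist_eq_norm] using hjy

/-! ### Averaging over an action of `ℤ²` with joint eigenvectors -/

section Ergodic

variable {A B : Type*} [CStarAlgebra A] [CStarAlgebra B]

/-- The action of `ℤ²` given by a pair of automorphisms. -/
def pairAct (α β : A ≃⋆ₐ[ℂ] A) (p : ℤ × ℤ) : A ≃⋆ₐ[ℂ] A := α ^ p.1 * β ^ p.2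

lemma pairAct_add {α β : A ≃⋆ₐ[ℂ] A} (h : Commute α β) (p q : ℤ × ℤ) (a : A) :
    pairAct α β p (pairAct α β q a) = pairAct α β (p + q) a := by
  have : pairAct α β p * pairAct α β q = pairAct α β (p + q) := by
    simp only [pairAct, Prod.fst_add, Prod.snd_add, zpow_add]
    rw [mul_assoc, ← mul_assoc (β ^ p.2), (h.zpow_zpow q.1 p.2).eq.symm]
    simp only [mul_assoc]
  rw [← this]; rfl

lemma zpow_apply_eigenvector {α : A ≃⋆ₐ[ℂ] A} {x : A} {c : ℂ} (hc : c ≠ 0) (h : α x = c • x)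
    (j : ℤ) : (α ^ j) x = c ^ j • x := by
  induction j using Int.induction_on with
  | zero => simp
  | succ i ih =>
    rw [zpow_add_one, StarAlgEquiv.mul_apply, h, map_smul, ih, smul_smul, zpow_add_one₀ hc,
      mul_comm]
  | pred i ih =>
    have h' : α⁻¹ x = c⁻¹ • x := by
      rw [eq_inv_smul_iff₀ hc, ← map_smul, ← h]
      exact α.symm_apply_apply x
    rw [zpow_sub_one, StarAlgEquiv.mul_apply, h', map_smul, ih, smul_smul, zpow_sub_one₀ hc,
      mul_comm]

lemma pairAct_apply_eigenvector {α β : A ≃⋆ₐ[ℂ] A} {x : A} {c d : ℂ} (hc : c ≠ 0) (hd : d ≠ 0)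
    (hα : α x = c • x) (hβ : β x = d • x) (p : ℤ × ℤ) :
    pairAct α β p x = (c ^ p.1 * d ^ p.2) • x := by
  rw [pairAct, StarAlgEquiv.mul_apply, zpow_apply_eigenvector hd hβ, map_smul,
    zpow_apply_eigenvector hc hα, smul_smul, mul_comm]

/-- The averages over the squares `[0, N)²` of the action of `ℤ²` given by a pair of
automorphisms. -/
def pairMean (α β : A ≃⋆ₐ[ℂ] A) (N : ℕ) (a : A) : A :=
  ((N : ℂ)⁻¹ * (N : ℂ)⁻¹) • ∑ j ∈ Finset.range N, ∑ k ∈ Finset.range N, pairAct α β (j, k) a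

lemma pairMean_add (α β : A ≃⋆ₐ[ℂ] A) (N : ℕ) (a b : A) :
    pairMean α β N (a + b) = pairMean α β N a + pairMean α β N b := by
  simp [pairMean, Finset.sum_add_distrib]

lemma pairMean_sub (α β : A ≃⋆ₐ[ℂ] A) (N : ℕ) (a b : A) :
    pairMean α β N (a - b) = pairMean α β N a - pairMean α β N b := by
  simp [pairMean, Finset.sum_sub_distrib, smul_sub]

lemma pairMean_smul (α β : A ≃⋆ₐ[ℂ] A) (N : ℕ) (c : ℂ) (a : A) :
    pairMean α β N (c • a) = c • pairMean α β N a := by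
  simp [pairMean, ← Finset.smul_sum, smul_comm c]

lemma norm_mean_le {N : ℕ} {f : ℕ → ℕ → A} {r : ℝ} (hr : 0 ≤ r) (hf : ∀ j k, ‖f j k‖ ≤ r) :
    ‖((N : ℂ)⁻¹ * (N : ℂ)⁻¹) • ∑ j ∈ Finset.range N, ∑ k ∈ Finset.range N, f j k‖ ≤ r := by
  -- For `N = 0` the mean is `0`, and only `0 ≤ r` is needed.
  rcases eq_or_ne N 0 with rfl | hN
  · simpa using hr
  have h1 : ‖∑ j ∈ Finset.range N, ∑ k ∈ Finset.range N, f j k‖ ≤ N * (N * r) := by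
    refine (norm_sum_le_of_le (n := fun _ => N * r) _ fun j _ => ?_).trans (by simp)
    exact (norm_sum_le_of_le (n := fun _ => r) _ fun k _ => hf j k).trans (by simp)
  have hN' : (0 : ℝ) < N := by positivity
  rw [norm_smul, norm_mul, norm_inv, Complex.norm_natCast]
  calc _ ≤ (N : ℝ)⁻¹ * (N : ℝ)⁻¹ * (N * (N * r)) := by gcongr
    _ = r := by field_simp

lemma norm_pairMean_le (α β : A ≃⋆ₐ[ℂ] A) (N : ℕ) (a : A) : ‖pairMean α β N a‖ ≤ ‖a‖ :=
  norm_mean_le (norm_nonneg _) fun _ _ => (StarAlgEquiv.norm_map _ _).le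

lemma pairMean_eigenvector {α β : A ≃⋆ₐ[ℂ] A} {x : A} {c d : ℂ} (hc : c ≠ 0) (hd : d ≠ 0)
    (hα : α x = c • x) (hβ : β x = d • x) (N : ℕ) :
    pairMean α β N x = (((N : ℂ)⁻¹ * ∑ j ∈ Finset.range N, c ^ j) *
      ((N : ℂ)⁻¹ * ∑ k ∈ Finset.range N, d ^ k)) • x := by
  simp only [pairMean, pairAct_apply_eigenvector hc hd hα hβ, zpow_natCast, ← Finset.sum_smul,
    ← Finset.sum_mul_sum, smul_smul]
  congr 1
  ring

/-- The hypotheses under which the averages of an action of `ℤ²` converge to scalars: the span of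
`E` is dense, and `E` consists of joint eigenvectors whose eigenvalues are powers of `z`, the
fixed ones being scalars. -/
structure ErgodicFamily (α β : A ≃⋆ₐ[ℂ] A) (z : ℂ) (E : Set A) : Prop where
  comm : Commute α β
  norm_eq : ‖z‖ = 1
  zpow_eq : ∀ n : ℤ, z ^ n = 1 → n = 0
  dense : Dense (Submodule.span ℂ E : Set A)
  eigen : ∀ x ∈ E, ∃ m n : ℤ, α x = z ^ m • x ∧ β x = z ^ n • x ∧
    (m = 0 → n = 0 → ∃ c : ℂ, x = algebraMap ℂ A c)

namespace ErgodicFamily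

variable {α β : A ≃⋆ₐ[ℂ] A} {z : ℂ} {E : Set A}

lemma ne_zero (h : ErgodicFamily α β z E) : z ≠ 0 := fun h0 => by
  simpa [h0] using h.norm_eq

lemma exists_tendsto_pairMean (h : ErgodicFamily α β z E) {x : A}
    (hx : x ∈ Submodule.span ℂ E) :
    ∃ c : ℂ, Tendsto (fun N => pairMean α β N x) atTop (𝓝 (algebraMap ℂ A c)) := by
  induction hx using Submodule.span_induction with
  | mem x hx =>
    obtain ⟨m, n, hα, hβ, hfix⟩ := h.eigen x hx
    have hm : ‖z ^ m‖ = 1 := by simp [norm_zpow, h.norm_eq]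
    have hn : ‖z ^ n‖ = 1 := by simp [norm_zpow, h.norm_eq]
    have hlim := ((tendsto_mean_pow hm).mul (tendsto_mean_pow hn)).smul_const x
    simp only [← pairMean_eigenvector (zpow_ne_zero m h.ne_zero) (zpow_ne_zero n h.ne_zero) hα hβ]
      at hlim
    by_cases hmn : m = 0 ∧ n = 0
    · obtain ⟨c, hc⟩ := hfix hmn.1 hmn.2
      exact ⟨c, by simpa [hmn.1, hmn.2, ← hc] using hlim⟩
    · refine ⟨0, ?_⟩
      -- No nonzero power of `z` is `1`, so one of the two one-dimensional means tends to `0`.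
      have : (if z ^ m = 1 then (1 : ℂ) else 0) * (if z ^ n = 1 then 1 else 0) = 0 := by
        by_contra hne
        rw [mul_eq_zero, not_or] at hne
        refine hmn ⟨h.zpow_eq m ?_, h.zpow_eq n ?_⟩
        · by_contra h1; exact hne.1 (if_neg h1)
        · by_contra h1; exact hne.2 (if_neg h1)
      simpa [this] using hlim
  | zero => exact ⟨0, by simp [pairMean]⟩
  | add x y _ _ hx hy =>
    obtain ⟨c, hc⟩ := hx
    obtain ⟨d, hd⟩ := hy
    exact ⟨c + d, by simpa [pairMean_add] using hc.add hd⟩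
  | smul r x _ hx =>
    obtain ⟨c, hc⟩ := hx
    refine ⟨r * c, ?_⟩
    have := hc.const_smul r
    simpa only [pairMean_smul, Algebra.smul_def r (algebraMap ℂ A c), ← map_mul] using this

/-- The action is recurrent: `pairAct α β p a` is close to `a` when the powers of `z` with exponents
`p.1` and `p.2` are close to `1`. -/
lemma tendsto_pairAct (h : ErgodicFamily α β z E) (a : A) :
    Tendsto (fun p => pairAct α β p a)
      (comap (fun j : ℤ => z ^ j) (𝓝 1) ×ˢ comap (fun j : ℤ => z ^ j) (𝓝 1)) (𝓝 a) := by
  set l := comap (fun j : ℤ => z ^ j) (𝓝 1) with hl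
  have hzl : Tendsto (fun j : ℤ => z ^ j) l (𝓝 1) := tendsto_comap
  have key : ∀ x ∈ Submodule.span ℂ E, Tendsto (fun p => pairAct α β p x) (l ×ˢ l) (𝓝 x) := by
    intro x hx
    induction hx using Submodule.span_induction with
    | mem x hx =>
      obtain ⟨m, n, hα, hβ, -⟩ := h.eigen x hx
      simp only [pairAct_apply_eigenvector (zpow_ne_zero m h.ne_zero) (zpow_ne_zero n h.ne_zero)
        hα hβ, ← zpow_mul]
      have hpow : ∀ m : ℤ, Tendsto (fun j : ℤ => z ^ (m * j)) l (𝓝 1) := fun m => by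
        simpa [mul_comm m, zpow_mul] using hzl.zpow₀ m (Or.inl one_ne_zero)
      simpa using (((hpow m).comp tendsto_fst).mul ((hpow n).comp tendsto_snd)).smul_const x
    | zero => simpa using tendsto_const_nhds
    | add x y _ _ hx hy => simpa using hx.add hy
    | smul r x _ hx => simpa using hx.const_smul r
  rw [Metric.tendsto_nhds]
  intro ε hε
  -- The action is isometric, so convergence passes from the dense span to `a`.
  obtain ⟨x, hx, hax⟩ := Metric.dense_iff.1 h.dense a (ε / 3) (by positivity)
  rw [Metric.mem_ball, dist_eq_norm] at hx
  filter_upwards [Metric.tendsto_nhds.1 (key x hax) (ε / 3) (by positivity)] with p hp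
  rw [dist_eq_norm] at hp ⊢
  have h1 : ‖pairAct α β p (a - x)‖ < ε / 3 := by
    rwa [StarAlgEquiv.norm_map, norm_sub_rev]
  rw [map_sub] at h1
  calc ‖pairAct α β p a - a‖
      = ‖(pairAct α β p a - pairAct α β p x) + (pairAct α β p x - x) + (x - a)‖ := by
        congr 1; abel
    _ ≤ _ := norm_add₃_le
    _ < ε / 3 + ε / 3 + ε / 3 := by gcongr
    _ = ε := by ring

/-- The near-return times of `a` have bounded gaps: each `p` differs from some near-return time by
an element of `F`. -/
lemma exists_finset_pairAct (h : ErgodicFamily α β z E) (a : A) {ε : ℝ} (hε : 0 < ε) :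
    ∃ F : Finset (ℤ × ℤ), ∀ p, ∃ q ∈ F, ‖pairAct α β (p - q) a - a‖ < ε := by
  have h1 := Metric.tendsto_nhds.1 (h.tendsto_pairAct a) ε hε
  have hb := (Metric.nhds_basis_ball (x := (1 : ℂ))).comap (fun j : ℤ => z ^ j)
  obtain ⟨δ, hδ, hsub⟩ := hb.prod_self.eventually_iff.1 h1
  obtain ⟨F, hF⟩ := exists_finset_zpow_approx h.norm_eq hδ
  refine ⟨F ×ˢ F, fun p => ?_⟩
  obtain ⟨i, hi, hi'⟩ := hF p.1
  obtain ⟨k, hk, hk'⟩ := hF p.2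
  refine ⟨(i, k), Finset.mk_mem_product hi hk, ?_⟩
  have := @hsub (p - (i, k)) (by simpa [dist_eq_norm] using ⟨hi', hk'⟩)
  rwa [dist_eq_norm] at this

/-- A ⋆-homomorphism to a nonzero algebra whose kernel is invariant is injective. -/
theorem injective (h : ErgodicFamily α β z E) [Nontrivial B] (π : A →⋆ₐ[ℂ] B)
    (hker : ∀ p a, π a = 0 → π (pairAct α β p a) = 0) : Function.Injective π := by
  let _ := CStarAlgebra.spectralOrder A
  have _ := CStarAlgebra.spectralOrderedRing A
  rw [injective_iff_map_eq_zero]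
  intro a ha
  by_contra hane
  set b := star a * a with hb
  have hπb : π b = 0 := by simp [hb, ha]
  have hbpos : 0 < ‖b‖ := norm_pos_iff.2 (by simpa [hb] using hane)
  -- The estimates end in `‖b‖ < 5ε`, so `‖b‖ / 8` leaves room to spare.
  obtain ⟨ε, hε⟩ : ∃ ε, ε = ‖b‖ / 8 := ⟨_, rfl⟩
  have hεpos : 0 < ε := by rw [hε]; positivity
  have hnn : ∀ p, 0 ≤ pairAct α β p b := fun p => by
    simp only [hb, map_mul, map_star]
    exact star_mul_self_nonneg _
  obtain ⟨F, hF⟩ := h.exists_finset_pairAct b hεpos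
  choose q hqF hq using hF
  set b' := ∑ q ∈ F, pairAct α β (-q) b with hb'
  have hπb' : π b' = 0 := by
    rw [hb', map_sum]
    exact Finset.sum_eq_zero fun q _ => hker _ _ hπb
  -- The translate of `b'` by `p` is a sum of positive terms, one of which is the translate of `b`
  -- by `p - q p`, within `ε` of `b`.
  have hact : ∀ p, pairAct α β (p - q p) b ≤ pairAct α β p b' := fun p => by
    simp only [hb', map_sum, pairAct_add h.comm, ← sub_eq_add_neg]
    exact Finset.single_le_sum (f := fun q => pairAct α β (p - q) b) (fun q _ => hnn _) (hqF p)
  obtain ⟨x, hx, hxE⟩ := Metric.dense_iff.1 h.dense b' ε hεpos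
  rw [Metric.mem_ball, dist_eq_norm] at hx
  obtain ⟨c, hc⟩ := h.exists_tendsto_pairMean hxE
  obtain ⟨N, hN, hN0⟩ := ((Metric.tendsto_nhds.1 hc ε hεpos).and (eventually_ne_atTop 0)).exists
  rw [dist_eq_norm] at hN
  have hNc : (N : ℂ) ≠ 0 := by exact_mod_cast hN0
  have hclose : ‖pairMean α β N b' - algebraMap ℂ A c‖ < 2 * ε := by
    calc _ = ‖(pairMean α β N b' - pairMean α β N x) +
          (pairMean α β N x - algebraMap ℂ A c)‖ := by congr 1; abel
      _ ≤ _ := norm_add_le _ _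
      _ < ε + ε := by
        gcongr
        rw [← pairMean_sub]
        exact (norm_pairMean_le α β N _).trans_lt (by rwa [norm_sub_rev])
      _ = 2 * ε := by ring
  have hπmean : π (pairMean α β N b') = 0 := by
    simp [pairMean, map_sum, hker _ _ hπb']
  -- `π` is contractive, kills the mean and fixes scalars.
  have hcsmall : ‖c‖ < 2 * ε := by
    have h1 := NonUnitalStarAlgHom.norm_apply_le π (pairMean α β N b' - algebraMap ℂ A c)
    rw [map_sub, hπmean, zero_sub, norm_neg, AlgHomClass.commutes, norm_algebraMap'] at h1
    exact h1.trans_lt hclose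
  have hupper : ‖pairMean α β N b'‖ < 4 * ε := by
    have : Nontrivial A := ⟨a, 0, hane⟩
    calc _ = ‖(pairMean α β N b' - algebraMap ℂ A c) + algebraMap ℂ A c‖ := by congr 1; abel
      _ ≤ _ := norm_add_le _ _
      _ < 2 * ε + 2 * ε := by rw [norm_algebraMap']; gcongr
      _ = 4 * ε := by ring
  -- The average of the terms selected by `hact`: it lies below the mean of `b'` and within `ε` of
  -- `b`.
  set d := ((N : ℂ)⁻¹ * (N : ℂ)⁻¹) • ∑ j ∈ Finset.range N, ∑ k ∈ Finset.range N,
    pairAct α β (((j : ℤ), (k : ℤ)) - q ((j : ℤ), (k : ℤ))) b with hd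
  have hreal : ((N : ℂ)⁻¹ * (N : ℂ)⁻¹) = (((N : ℝ)⁻¹ * (N : ℝ)⁻¹ : ℝ) : ℂ) := by push_cast; rfl
  have hr0 : (0 : ℝ) ≤ (N : ℝ)⁻¹ * (N : ℝ)⁻¹ := by positivity
  have hd0 : 0 ≤ d := by
    rw [hd, hreal, Complex.coe_smul]
    exact smul_nonneg hr0 (Finset.sum_nonneg fun j _ => Finset.sum_nonneg fun k _ => hnn _)
  have hdle : d ≤ pairMean α β N b' := by
    rw [hd, pairMean, hreal, Complex.coe_smul, Complex.coe_smul]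
    exact smul_le_smul_of_nonneg_left
      (Finset.sum_le_sum fun j _ => Finset.sum_le_sum fun k _ => hact _) hr0
  have hdb : ‖d - b‖ ≤ ε := by
    -- A constant is its own average; this is where `N ≠ 0` matters.
    have : b = ((N : ℂ)⁻¹ * (N : ℂ)⁻¹) • ∑ j ∈ Finset.range N, ∑ k ∈ Finset.range N, b := by
      simp only [Finset.sum_const, Finset.card_range, ← Nat.cast_smul_eq_nsmul ℂ, smul_smul]
      field_simp
      simp
    rw [hd]
    nth_rewrite 2 [this]
    rw [← smul_sub, ← Finset.sum_sub_distrib]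
    simp only [← Finset.sum_sub_distrib]
    exact norm_mean_le hεpos.le fun j k => (hq ((j : ℤ), (k : ℤ))).le
  have h1 : ‖d‖ ≤ ‖pairMean α β N b'‖ := CStarAlgebra.norm_le_norm_of_nonneg_of_le hd0 hdle
  have h2 : ‖b‖ ≤ ‖d‖ + ‖d - b‖ := by
    calc ‖b‖ = ‖d - (d - b)‖ := by congr 1; abel
      _ ≤ _ := norm_sub_le _ _
  linarith

end ErgodicFamily

end Ergodic

/-! ### Pairs of unitaries satisfying the rotation relation -/

section Group

variable {G : Type*} [Group G] {U V L : G}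

/-- Each exchange of one `V` with one `U` costs a central factor `L⁻¹`, and `n * m` exchanges occur.
-/
lemma zpow_mul_zpow_of_central (hL : ∀ g, Commute L g) (h : U * V = L * (V * U)) (n m : ℤ) :
    V ^ n * U ^ m = L ^ (-(n * m)) * (U ^ m * V ^ n) := by
  have h1 : SemiconjBy U V (L * V) := by rw [SemiconjBy, h, mul_assoc]
  have h2 : U * V ^ n = L ^ n * V ^ n * U := by
    rw [← (hL V).mul_zpow]; exact h1.zpow_right n
  have h3 : SemiconjBy (V ^ n) U (L ^ (-n) * U) := by
    rw [SemiconjBy, mul_assoc, h2, ← mul_assoc, ← mul_assoc, ← zpow_add]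
    simp
  have h4 := h3.zpow_right m
  rw [SemiconjBy, (((hL U).zpow_left (-n))).mul_zpow, ← zpow_mul, neg_mul, mul_assoc] at h4
  exact h4

end Group

/-- The scalars of modulus one as unitaries. -/
def scalarUnitary (A : Type*) [CStarAlgebra A] : unitary ℂ →⋆* unitary A :=
  Unitary.map
    { toFun := algebraMap ℂ A
      map_one' := map_one _
      map_mul' := map_mul _
      map_star' := algebraMap_star_comm }

section RotationUnitaries

variable {A : Type*} [CStarAlgebra A]

lemma coe_scalarUnitary_zpow (ζ : unitary ℂ) (n : ℤ) :
    ((scalarUnitary A ζ ^ n : unitary A) : A) = algebraMap ℂ A ((ζ : ℂ) ^ n) := by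
  rw [← map_zpow, ← Unitary.coe_zpow]; rfl

lemma scalarUnitary_commute (ζ : unitary ℂ) (g : unitary A) : Commute (scalarUnitary A ζ) g :=
  Subtype.ext (Algebra.commutes (ζ : ℂ) (g : A))

variable {U V : unitary A} {ζ : unitary ℂ}

lemma conj_commute (h : U * V = scalarUnitary A ζ * (V * U)) :
    Commute (Unitary.conjStarAlgAut ℂ A U) (Unitary.conjStarAlgAut ℂ A V) := by
  have hz : Unitary.conjStarAlgAut ℂ A (scalarUnitary A ζ) = 1 := by
    ext a
    have hcomm : (scalarUnitary A ζ : A) * a = a * (scalarUnitary A ζ : A) :=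
      Algebra.commutes (ζ : ℂ) a
    rw [Unitary.conjStarAlgAut_apply, hcomm, mul_assoc]
    simp
  rw [Commute, SemiconjBy, ← map_mul, ← map_mul, h, map_mul, hz, one_mul]

lemma conj_apply_of_mul_eq {W X : unitary A} {n : ℤ}
    (h : W * X = scalarUnitary A ζ ^ n * (X * W)) :
    Unitary.conjStarAlgAut ℂ A W (X : A) = (ζ : ℂ) ^ n • (X : A) := by
  have h' : W * X * star W = scalarUnitary A ζ ^ n * X := by
    rw [h, mul_assoc, mul_assoc, Unitary.mul_star_self, mul_one]
  rw [Unitary.conjStarAlgAut_apply, Algebra.smul_def, ← coe_scalarUnitary_zpow]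
  exact congrArg Subtype.val h'

/-- Reordering a word in the generators and their adjoints costs only powers of `ζ`. Such words span
the ⋆-algebra generated by `U` and `V`, so ordered monomials suffice for the eigenvector analysis.
-/
lemma exists_eq_smul_of_mem_closure (h : U * V = scalarUnitary A ζ * (V * U)) {x : A}
    (hx : x ∈ Submonoid.closure (({(U : A), (V : A)} : Set A) ∪ star {(U : A), (V : A)})) :
    ∃ (m n k : ℤ), x = ((scalarUnitary A ζ ^ k * (U ^ m * V ^ n) : unitary A) : A) := by
  induction hx using Submonoid.closure_induction with
  | mem x hx =>
    rcases hx with (rfl | rfl) | hx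
    · exact ⟨1, 0, 0, by simp⟩
    · exact ⟨0, 1, 0, by simp⟩
    · rcases hx with hx | hx
      · exact ⟨-1, 0, 0, by rw [← star_star x, hx]; simp [← Unitary.star_eq_inv]⟩
      · exact ⟨0, -1, 0, by rw [← star_star x, hx]; simp [← Unitary.star_eq_inv]⟩
  | one => exact ⟨0, 0, 0, by simp⟩
  | mul x y _ _ hx hy =>
    obtain ⟨m, n, k, rfl⟩ := hx
    obtain ⟨m', n', k', rfl⟩ := hy
    -- The extra exponent `-(n * m')` comes from moving `V ^ n` past `U ^ m'`.
    refine ⟨m + m', n + n', k + k' + -(n * m'), ?_⟩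
    rw [← Submonoid.coe_mul]
    congr 1
    have hL := scalarUnitary_commute (A := A) ζ
    set L := scalarUnitary A ζ
    have hL' : ∀ (k : ℤ) (g : unitary A), g * L ^ k = L ^ k * g :=
      fun k g => ((hL g).zpow_left k).eq.symm
    calc L ^ k * (U ^ m * V ^ n) * (L ^ k' * (U ^ m' * V ^ n'))
        = L ^ k * ((U ^ m * V ^ n) * L ^ k') * (U ^ m' * V ^ n') := by group
      _ = L ^ k * L ^ k' * (U ^ m * (V ^ n * U ^ m') * V ^ n') := by
        rw [hL' k']; simp only [mul_assoc]
      _ = L ^ k * L ^ k' * ((U ^ m * L ^ (-(n * m'))) * U ^ m' * V ^ n * V ^ n') := by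
        rw [zpow_mul_zpow_of_central hL h]; simp only [mul_assoc]
      _ = _ := by
        rw [hL' _ (U ^ m)]
        simp only [zpow_add, mul_assoc]

theorem ergodicFamily_of_dense (h : U * V = scalarUnitary A ζ * (V * U))
    (hζ : ∀ n : ℤ, (ζ : ℂ) ^ n = 1 → n = 0)
    (hd : Dense (StarAlgebra.adjoin ℂ {(U : A), (V : A)} : Set A)) :
    ErgodicFamily (Unitary.conjStarAlgAut ℂ A U) (Unitary.conjStarAlgAut ℂ A V) (ζ : ℂ)
      (Submonoid.closure (({(U : A), (V : A)} : Set A) ∪ star {(U : A), (V : A)})) where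
  comm := conj_commute h
  norm_eq := CStarRing.norm_coe_unitary ζ
  zpow_eq := hζ
  dense := by
    rw [← StarAlgebra.adjoin_eq_span]
    exact hd
  eigen x hx := by
    obtain ⟨m, n, k, rfl⟩ := exists_eq_smul_of_mem_closure h hx
    have hL := scalarUnitary_commute (A := A) ζ
    have key := zpow_mul_zpow_of_central hL h
    -- `Ad U` sees only the power of `V`, and `Ad V` only that of `U`, with the opposite sign. If
    -- both eigenvalue exponents vanish, the monomial is the scalar `ζ ^ k`.
    refine ⟨n, -m, conj_apply_of_mul_eq ?_, conj_apply_of_mul_eq ?_, ?_⟩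
    · set L := scalarUnitary A ζ
      have hL' : ∀ (k : ℤ) (g : unitary A), g * L ^ k = L ^ k * g :=
        fun k g => ((hL g).zpow_left k).eq.symm
      have h1 : V ^ n * U = L ^ (-n) * (U * V ^ n) := by simpa using key n 1
      have h2 : U * V ^ n = L ^ n * (V ^ n * U) := by rw [h1, ← mul_assoc, ← zpow_add]; simp
      calc U * (L ^ k * (U ^ m * V ^ n)) = U * L ^ k * U ^ m * V ^ n := by group
        _ = L ^ k * U ^ m * (U * V ^ n) := by rw [hL']; group
        _ = L ^ k * (U ^ m * L ^ n) * V ^ n * U := by rw [h2]; group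
        _ = L ^ k * L ^ n * U ^ m * V ^ n * U := by rw [hL']; group
        _ = _ := by group
    · set L := scalarUnitary A ζ
      have hL' : ∀ (k : ℤ) (g : unitary A), g * L ^ k = L ^ k * g :=
        fun k g => ((hL g).zpow_left k).eq.symm
      have h1 : V * U ^ m = L ^ (-m) * (U ^ m * V) := by simpa using key 1 m
      calc V * (L ^ k * (U ^ m * V ^ n)) = V * L ^ k * U ^ m * V ^ n := by group
        _ = L ^ k * (V * U ^ m) * V ^ n := by rw [hL']; group
        _ = _ := by rw [h1]; group
    · rintro rfl hm
      obtain rfl : m = 0 := by omega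
      exact ⟨(ζ : ℂ) ^ k, by rw [← coe_scalarUnitary_zpow]; simp⟩

/-- A C⋆-algebra generated by two unitaries satisfying the rotation relation for a parameter that is
not a root of unity is simple, in the form: its ⋆-homomorphisms to nonzero algebras are
injective. -/
theorem injective_of_dense {B : Type*} [CStarAlgebra B] [Nontrivial B]
    (h : U * V = scalarUnitary A ζ * (V * U)) (hζ : ∀ n : ℤ, (ζ : ℂ) ^ n = 1 → n = 0)
    (hd : Dense (StarAlgebra.adjoin ℂ {(U : A), (V : A)} : Set A)) (π : A →⋆ₐ[ℂ] B) :
    Function.Injective π := by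
  -- A kernel is a two-sided ideal, hence invariant under inner automorphisms.
  refine (ergodicFamily_of_dense h hζ hd).injective π fun p a ha => ?_
  rw [pairAct, ← map_zpow, ← map_zpow, ← map_mul, Unitary.conjStarAlgAut_apply, map_mul, map_mul,
    ha, mul_zero, zero_mul]

end RotationUnitaries

/-! ### The irrational rotation algebra -/

/-- The number `e^{2πiθ}` as a unitary. -/
def rotPhase (θ : ℝ) : unitary ℂ :=
  ⟨Complex.exp (2 * Real.pi * Complex.I * θ), by
    have h : (2 * Real.pi * Complex.I * θ : ℂ) = ((2 * Real.pi * θ : ℝ) : ℂ) * Complex.I := by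
      push_cast; ring
    rw [h, Unitary.mem_iff_self_mul_star, RCLike.star_def, Complex.mul_conj,
      Complex.normSq_eq_norm_sq, Complex.norm_exp_ofReal_mul_I]
    simp⟩

lemma coe_rotPhase (θ : ℝ) : (rotPhase θ : ℂ) = Complex.exp (2 * Real.pi * Complex.I * θ) := rfl

lemma rotPhase_zpow_eq_one {θ : ℝ} (hθ : Irrational θ) (n : ℤ) (h : (rotPhase θ : ℂ) ^ n = 1) :
    n = 0 := by
  rw [coe_rotPhase, ← Complex.exp_int_mul, Complex.exp_eq_one_iff] at h
  obtain ⟨k, hk⟩ := h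
  have hne : (2 * Real.pi * Complex.I : ℂ) ≠ 0 := Complex.two_pi_I_ne_zero
  have h1 : ((n * θ : ℝ) : ℂ) = ((k : ℝ) : ℂ) := by
    apply mul_right_cancel₀ hne
    push_cast
    rw [← hk]; ring
  have h2 : (n : ℝ) * θ = k := by exact_mod_cast h1
  by_contra hn
  have := (hθ.intCast_mul hn).ne_int k
  exact this h2

lemma dense_adjoin_rot (θ : ℝ) :
    Dense (StarAlgebra.adjoin ℂ {rotU.{w} θ, rotV.{w} θ} : Set (rotationAlgebra.{w} θ)) := by
  rw [Subtype.dense_iff]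
  intro x hx
  have : ((↑) '' (StarAlgebra.adjoin ℂ {rotU.{w} θ, rotV.{w} θ} : Set (rotationAlgebra.{w} θ)) :
      Set (RotationProduct.{w} θ)) = StarAlgebra.adjoin ℂ {prodU.{w} θ, prodV.{w} θ} := by
    have := congrArg (SetLike.coe (B := RotationProduct.{w} θ))
      (StarAlgHom.map_adjoin (rotationAlgebra.{w} θ).subtype {rotU.{w} θ, rotV.{w} θ})
    rw [Set.image_pair] at this
    exact this
  exact (Set.ext_iff.1 (congrArg closure this) x).2 hx

theorem rotationAlgebra_hom_injective {θ : ℝ} (hθ : Irrational θ) {B : Type*} [CStarAlgebra B]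
    [Nontrivial B] (π : rotationAlgebra.{w} θ →⋆ₐ[ℂ] B) : Function.Injective π := by
  refine injective_of_dense (U := ⟨rotU.{w} θ, rotU_mem_unitary θ⟩)
    (V := ⟨rotV.{w} θ, rotV_mem_unitary θ⟩) (ζ := rotPhase θ) ?_ (rotPhase_zpow_eq_one hθ)
    (dense_adjoin_rot θ) π
  refine Subtype.ext ((rot_rel.{w} θ).trans ?_)
  rw [Algebra.smul_def]
  rfl

/-! ### The universal property for algebras in a smaller universe -/

section ULift

variable (B : Type) [CStarAlgebra B]

instance : StarRing (ULift.{w} B) where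
  star x := ⟨star x.down⟩
  star_involutive x := ULift.ext _ _ (star_star x.down)
  star_mul x y := ULift.ext _ _ (star_mul x.down y.down)
  star_add x y := ULift.ext _ _ (star_add x.down y.down)

instance : CStarAlgebra (ULift.{w} B) where
  norm_mul_self_le x := CStarRing.norm_mul_self_le x.down
  star_smul c x := ULift.ext _ _ (star_smul c x.down)
  toCompleteSpace := inferInstance

variable {B}

/-- `existsUnique_lift` requires a target in `Type w`, whereas the operators on `ℓ²(ℤ)` live in
`Type`; the passage goes through `ULift`. -/
theorem exists_rotationAlgebra_hom (θ : ℝ) {a b : B} (ha : a ∈ unitary B) (hb : b ∈ unitary B)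
    (h : a * b = Complex.exp (2 * Real.pi * Complex.I * θ) • (b * a)) :
    ∃ φ : rotationAlgebra.{w} θ →⋆ₐ[ℂ] B, φ (rotU θ) = a ∧ φ (rotV θ) = b := by
  obtain ⟨φ, ⟨hφa, hφb⟩, -⟩ := existsUnique_lift.{w} θ (ULift.up.{w} a) (ULift.up.{w} b)
    ⟨ULift.ext _ _ ha.1, ULift.ext _ _ ha.2⟩ ⟨ULift.ext _ _ hb.1, ULift.ext _ _ hb.2⟩
    (ULift.ext _ _ h)
  let down : ULift.{w} B →⋆ₐ[ℂ] B :=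
    { toFun := ULift.down
      map_one' := rfl
      map_mul' := fun _ _ => rfl
      map_zero' := rfl
      map_add' := fun _ _ => rfl
      commutes' := fun _ => rfl
      map_star' := fun _ => rfl }
  exact ⟨down.comp φ, congrArg ULift.down hφa, congrArg ULift.down hφb⟩

end ULift

/-! ### Diagonal operators and the shift -/

lemma star_eq_of_forall_inner {S T : L2Z →L[ℂ] L2Z}
    (h : ∀ f g : L2Z, inner ℂ (S f) g = inner ℂ f (T g)) : star T = S := by
  rw [ContinuousLinearMap.star_eq_adjoint]
  exact ((ContinuousLinearMap.eq_adjoint_iff S T).2 h).symm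

/-- The ⋆-homomorphism from bounded sequences to diagonal operators. -/
def diagonalHom : BddSeq →⋆ₐ[ℂ] (L2Z →L[ℂ] L2Z) where
  toFun := diagonal
  map_one' := by ext f n; simp [diagonal, lp.infty_coeFn_one]
  map_mul' a b := by ext f n; simp [diagonal, lp.infty_coeFn_mul, mul_assoc]
  map_zero' := by ext f n; simp [diagonal]
  map_add' a b := by ext f n; simp [diagonal, add_mul]
  commutes' c := by
    ext f n
    simp [diagonal, Algebra.algebraMap_eq_smul_one, lp.infty_coeFn_one]
  map_star' a := by
    refine (star_eq_of_forall_inner fun f g => ?_).symm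
    simp only [lp.inner_eq_tsum]
    refine tsum_congr fun n => ?_
    simp [diagonal, mul_comm, mul_left_comm, mul_assoc]

lemma diagonalHom_apply (a : BddSeq) : diagonalHom a = diagonal a := rfl

/-- The inverse of the bilateral shift. -/
def shiftInv : L2Z →L[ℂ] L2Z := weightedPerm 1 (Equiv.addRight 1)

lemma star_shift : star shift = shiftInv := by
  refine star_eq_of_forall_inner fun f g => ?_
  simp only [lp.inner_eq_tsum]
  rw [← (Equiv.addRight (1 : ℤ)).tsum_eq (fun n => inner ℂ (f n) (shift g n))]
  refine tsum_congr fun n => ?_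
  simp [shift, shiftInv, lp.infty_coeFn_one]

lemma shift_mem_unitary : shift ∈ unitary (L2Z →L[ℂ] L2Z) := by
  rw [Unitary.mem_iff, star_shift]
  constructor <;> ext f n <;> simp [shift, shiftInv, lp.infty_coeFn_one]

/-- The translate of a bounded sequence by one. -/
def translate (a : BddSeq) : BddSeq :=
  ⟨fun n => a (n + 1), memℓp_infty ⟨‖a‖, by
    rintro _ ⟨n, rfl⟩
    exact lp.norm_apply_le_norm ENNReal.top_ne_zero a (n + 1)⟩⟩

@[simp] lemma translate_apply (a : BddSeq) (n : ℤ) : translate a n = a (n + 1) := rfl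

lemma star_shift_mul_diagonal_mul_shift (a : BddSeq) :
    star shift * diagonal a * shift = diagonal (translate a) := by
  rw [star_shift]
  ext f n
  simp [shift, shiftInv, diagonal, lp.infty_coeFn_one]

lemma weightedShift_eq (x : BddSeq) : weightedShift x = shift * diagonal x := rfl

/-- The shift cancels because it is an isometry; this is the source of diagonal operators in
`C⋆(T_x)`. -/
lemma star_weightedShift_mul_self (x : BddSeq) :
    star (weightedShift x) * weightedShift x = diagonal (star x * x) := by
  rw [weightedShift_eq, star_mul, mul_assoc, ← mul_assoc (star shift),
    (Unitary.mem_iff.1 shift_mem_unitary).1, one_mul, ← diagonalHom_apply, ← map_star, ← map_mul]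
  rfl

/-- Bounded sequences whose diagonal operator lies in a ⋆-subalgebra. -/
def diagonalSubalgebra (S : StarSubalgebra ℂ (L2Z →L[ℂ] L2Z)) : StarSubalgebra ℂ BddSeq :=
  S.comap diagonalHom

lemma mem_diagonalSubalgebra {S : StarSubalgebra ℂ (L2Z →L[ℂ] L2Z)} {a : BddSeq} :
    a ∈ diagonalSubalgebra S ↔ diagonal a ∈ S := Iff.rfl

open scoped CStarAlgebra in
lemma isClosed_diagonalSubalgebra {S : StarSubalgebra ℂ (L2Z →L[ℂ] L2Z)}
    (hS : IsClosed (S : Set (L2Z →L[ℂ] L2Z))) :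
    IsClosed (diagonalSubalgebra S : Set BddSeq) :=
  hS.preimage (map_continuous diagonalHom)

/-- A positive element lies in every closed ⋆-subalgebra that contains its square. -/
lemma mem_of_mul_self_mem {A : Type*} [CStarAlgebra A] {S : StarSubalgebra ℂ A}
    (hS : IsClosed (S : Set A)) {x y : A} (hxy : x = star y * y) (hx : x * x ∈ S) : x ∈ S := by
  let _ := CStarAlgebra.spectralOrder A
  have _ := CStarAlgebra.spectralOrderedRing A
  have hx0 : 0 ≤ x := hxy ▸ star_mul_self_nonneg y
  -- `x` is the positive square root of `x * x`, and functional calculus stays inside a closed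
  -- ⋆-subalgebra.
  rw [← CFC.sqrt_mul_self x, CFC.sqrt_eq_real_sqrt (x * x) (by
    simpa [hx0.isSelfAdjoint.star_eq] using star_mul_self_nonneg x)]
  exact cfcₙ_mem (𝕜' := ℂ) (𝕜 := ℝ) (s := S) Real.sqrt hx

/-! ### The weights -/

lemma cosWeight_apply (θ : ℝ) (n : ℤ) :
    cosWeight θ n = ((2 * Real.cos (2 * Real.pi * n * θ) + 3 : ℝ) : ℂ) := rfl

lemma phase_apply (θ : ℝ) (n : ℤ) :
    phase θ n = Complex.exp (2 * Real.pi * Complex.I * n * θ) := rfl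

lemma one_le_cosWeight (θ : ℝ) (n : ℤ) : 1 ≤ 2 * Real.cos (2 * Real.pi * n * θ) + 3 := by
  linarith [Real.neg_one_le_cos (2 * Real.pi * n * θ)]

lemma star_phase_apply (θ : ℝ) (n : ℤ) :
    star (phase θ) n = Complex.exp (-(2 * Real.pi * Complex.I * n * θ)) := by
  rw [lp.star_apply, phase_apply, RCLike.star_def, ← Complex.exp_conj]
  simp [Complex.conj_ofNat]

lemma cosWeight_eq (θ : ℝ) :
    cosWeight θ = phase θ + star (phase θ) + algebraMap ℂ BddSeq 3 := by
  ext n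
  rw [lp.coeFn_add, lp.coeFn_add, Pi.add_apply, Pi.add_apply, star_phase_apply, phase_apply,
    cosWeight_apply, Algebra.algebraMap_eq_smul_one, lp.coeFn_smul, Pi.smul_apply,
    lp.infty_coeFn_one]
  push_cast
  rw [Complex.cos]
  simp only [Pi.one_apply, smul_eq_mul, mul_one]
  ring_nf

lemma phase_mem_unitary (θ : ℝ) : phase θ ∈ unitary BddSeq := by
  rw [Unitary.mem_iff_self_mul_star]
  ext n
  rw [lp.infty_coeFn_mul, Pi.mul_apply, star_phase_apply, phase_apply, ← Complex.exp_add,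
    lp.infty_coeFn_one]
  simp

lemma translate_phase (θ : ℝ) : translate (phase θ) = (rotPhase θ : ℂ) • phase θ := by
  ext n
  rw [translate_apply, lp.coeFn_smul, Pi.smul_apply, phase_apply, phase_apply, coe_rotPhase,
    smul_eq_mul, ← Complex.exp_add]
  push_cast
  ring_nf

lemma translate_add (a b : BddSeq) : translate (a + b) = translate a + translate b := rfl

lemma translate_star (a : BddSeq) : translate (star a) = star (translate a) := rfl

lemma diagonal_phase_mem_unitary (θ : ℝ) : diagonal (phase θ) ∈ unitary (L2Z →L[ℂ] L2Z) :=
  Unitary.map_mem diagonalHom (phase_mem_unitary θ)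

lemma diagonal_phase_mul_shift (θ : ℝ) : diagonal (phase θ) * shift =
    Complex.exp (2 * Real.pi * Complex.I * θ) • (shift * diagonal (phase θ)) := by
  calc _ = shift * (star shift * diagonal (phase θ) * shift) := by
        rw [← mul_assoc, ← mul_assoc, (Unitary.mem_iff.1 shift_mem_unitary).2, one_mul]
    _ = shift * diagonalHom ((rotPhase θ : ℂ) • phase θ) := by
        rw [star_shift_mul_diagonal_mul_shift, translate_phase]; rfl
    _ = _ := by rw [map_smul, mul_smul_comm]; rfl

/-- The square roots of the weights. -/
def sqrtCosWeight (θ : ℝ) : BddSeq :=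
  ⟨fun n => (Real.sqrt (2 * Real.cos (2 * Real.pi * n * θ) + 3) : ℂ), memℓp_infty ⟨Real.sqrt 5, by
    rintro _ ⟨n, rfl⟩
    simp only [Complex.norm_real, Real.norm_eq_abs, abs_of_nonneg (Real.sqrt_nonneg _)]
    exact Real.sqrt_le_sqrt (by linarith [Real.cos_le_one (2 * Real.pi * n * θ)])⟩⟩

/-- The inverses of the weights. -/
def invCosWeight (θ : ℝ) : BddSeq :=
  ⟨fun n => ((2 * Real.cos (2 * Real.pi * n * θ) + 3)⁻¹ : ℝ), memℓp_infty ⟨1, by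
    rintro _ ⟨n, rfl⟩
    have := one_le_cosWeight θ n
    simp only [Complex.norm_real, Real.norm_eq_abs]
    rw [abs_of_nonneg (by positivity)]
    exact inv_le_one_of_one_le₀ this⟩⟩

lemma star_cosWeight (θ : ℝ) : star (cosWeight θ) = cosWeight θ := by
  ext n
  rw [lp.star_apply, cosWeight_apply, RCLike.star_def, Complex.conj_ofReal]

lemma cosWeight_eq_star_mul_self (θ : ℝ) :
    cosWeight θ = star (sqrtCosWeight θ) * sqrtCosWeight θ := by
  ext n
  rw [lp.infty_coeFn_mul, Pi.mul_apply, lp.star_apply, cosWeight_apply]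
  change _ = star (Real.sqrt _ : ℂ) * (Real.sqrt _ : ℂ)
  rw [RCLike.star_def, Complex.conj_ofReal, ← Complex.ofReal_mul,
    Real.mul_self_sqrt (by linarith [one_le_cosWeight θ n])]

lemma cosWeight_mul_invCosWeight (θ : ℝ) : cosWeight θ * invCosWeight θ = 1 := by
  ext n
  rw [lp.infty_coeFn_mul, Pi.mul_apply, cosWeight_apply, lp.infty_coeFn_one, Pi.one_apply]
  change _ * (((_ : ℝ)⁻¹ : ℝ) : ℂ) = 1
  rw [← Complex.ofReal_mul, mul_inv_cancel₀ (by linarith [one_le_cosWeight θ n]),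
    Complex.ofReal_one]

/-- Spectral permanence: an element of a closed ⋆-subalgebra that is invertible in the ambient
C⋆-algebra has its inverse in the subalgebra. -/
lemma invCosWeight_mem {S : StarSubalgebra ℂ BddSeq} (hS : IsClosed (S : Set BddSeq)) {θ : ℝ}
    (h : cosWeight θ ∈ S) : invCosWeight θ ∈ S := by
  have := hS
  have hu : IsUnit (cosWeight θ) := .of_mul_eq_one _ (cosWeight_mul_invCosWeight θ)
  obtain ⟨y, hy⟩ := ((StarSubalgebra.coe_isUnit S (a := ⟨cosWeight θ, h⟩)).1 hu).exists_right_inv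
  have hy' : cosWeight θ * (y : BddSeq) = 1 := congrArg Subtype.val hy
  have : invCosWeight θ = y := hu.mul_left_cancel ((cosWeight_mul_invCosWeight θ).trans hy'.symm)
  exact this ▸ y.2

/-! ### Equality of the two generated algebras -/

lemma isClosed_cstarGen {A : Type*} [NormedRing A] [NormedAlgebra ℂ A] [StarRing A]
    [StarModule ℂ A] [ContinuousStar A] (s : Set A) : IsClosed (cstarGen s : Set A) :=
  StarSubalgebra.isClosed_topologicalClosure _

lemma subset_cstarGen {A : Type*} [NormedRing A] [NormedAlgebra ℂ A] [StarRing A]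
    [StarModule ℂ A] [ContinuousStar A] (s : Set A) : s ⊆ cstarGen s :=
  (StarAlgebra.subset_adjoin ℂ s).trans (StarSubalgebra.le_topologicalClosure _)

lemma cstarGen_le {A : Type*} [NormedRing A] [NormedAlgebra ℂ A] [StarRing A]
    [StarModule ℂ A] [ContinuousStar A] {s : Set A} {S : StarSubalgebra ℂ A}
    (hS : IsClosed (S : Set A)) (h : s ⊆ S) : cstarGen s ≤ S :=
  StarSubalgebra.topologicalClosure_minimal (StarAlgebra.adjoin_le h) hS

theorem cstarGen_weightedShift_le (θ : ℝ) :
    cstarGen {weightedShift (cosWeight θ)} ≤ cstarGen {shift, diagonal (phase θ)} := by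
  refine cstarGen_le (isClosed_cstarGen _) ?_
  rw [Set.singleton_subset_iff]
  set S := cstarGen {shift, diagonal (phase θ)}
  have hT : shift ∈ S := subset_cstarGen _ (by simp)
  have hD : phase θ ∈ diagonalSubalgebra S :=
    mem_diagonalSubalgebra.2 (subset_cstarGen _ (by simp))
  have hx : cosWeight θ ∈ diagonalSubalgebra S := by
    rw [cosWeight_eq]
    exact add_mem (add_mem hD (star_mem hD)) (algebraMap_mem _ 3)
  exact mul_mem hT hx

theorem le_cstarGen_weightedShift {θ : ℝ} (hθ : Irrational θ) :
    cstarGen {shift, diagonal (phase θ)} ≤ cstarGen {weightedShift (cosWeight θ)} := by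
  refine cstarGen_le (isClosed_cstarGen _) ?_
  set S := cstarGen {weightedShift (cosWeight θ)}
  have hcl := isClosed_diagonalSubalgebra (S := S) (isClosed_cstarGen _)
  have hTx : weightedShift (cosWeight θ) ∈ S := subset_cstarGen _ (by simp)
  have hx : cosWeight θ ∈ diagonalSubalgebra S := by
    refine mem_of_mul_self_mem hcl (cosWeight_eq_star_mul_self θ) ?_
    nth_rewrite 1 [← star_cosWeight]
    rw [mem_diagonalSubalgebra, ← star_weightedShift_mul_self]
    exact mul_mem (star_mem hTx) hTx
  have hT : shift ∈ S := by
    have hinv : diagonal (invCosWeight θ) ∈ S := invCosWeight_mem hcl hx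
    have : shift = weightedShift (cosWeight θ) * diagonal (invCosWeight θ) := by
      rw [weightedShift_eq, mul_assoc, ← diagonalHom_apply, ← diagonalHom_apply, ← map_mul,
        cosWeight_mul_invCosWeight, map_one, mul_one]
    exact this ▸ mul_mem hTx hinv
  have htr : ∀ a ∈ diagonalSubalgebra S, translate a ∈ diagonalSubalgebra S := fun a ha => by
    rw [mem_diagonalSubalgebra, ← star_shift_mul_diagonal_mul_shift]
    exact mul_mem (mul_mem (star_mem hT) ha) hT
  have hc : phase θ + star (phase θ) ∈ diagonalSubalgebra S := by
    have := sub_mem hx (algebraMap_mem (diagonalSubalgebra S) 3)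
    rwa [cosWeight_eq, add_sub_cancel_right] at this
  set ζ : ℂ := (rotPhase θ : ℂ) with hζ
  have hζ' : ζ * star ζ = 1 := (Unitary.mem_iff.1 (rotPhase θ).2).2
  -- `ζ = ζ̄` would give `ζ² = 1`, which irrationality of `θ` excludes.
  have hne : ζ - star ζ ≠ 0 := fun h0 => by
    have h1 : ζ ^ (2 : ℤ) = 1 := by
      rw [← hζ', ← sub_eq_zero.1 h0]
      exact zpow_ofNat ζ 2 |>.trans (sq ζ)
    simpa using rotPhase_zpow_eq_one hθ 2 h1
  have hD : phase θ ∈ diagonalSubalgebra S := by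
    -- Subtracting `ζ̄(p + p̄)` from the translate `ζp + ζ̄p̄` eliminates `p̄` and leaves `(ζ -
    -- ζ̄)p`.
    have hd : phase θ = (ζ - star ζ)⁻¹ • (translate (phase θ + star (phase θ)) -
        star ζ • (phase θ + star (phase θ))) := by
      rw [eq_inv_smul_iff₀ hne, translate_add, translate_star, translate_phase, star_smul]
      module
    rw [hd]
    exact SMulMemClass.smul_mem _ (sub_mem (htr _ hc) (SMulMemClass.smul_mem _ hc))
  rintro _ (rfl | rfl)
  · exact hT
  · exact hD

theorem cstarGen_weightedShift {θ : ℝ} (hθ : Irrational θ) :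
    cstarGen {weightedShift (cosWeight θ)} = cstarGen {shift, diagonal (phase θ)} :=
  le_antisymm (cstarGen_weightedShift_le θ) (le_cstarGen_weightedShift hθ)

/-- An injective ⋆-homomorphism of C⋆-algebras is isometric, so it is a closed map and taking images
commutes with taking closures. -/
lemma map_top_rotationAlgebra {θ : ℝ} {B : Type*} [CStarAlgebra B]
    (φ : rotationAlgebra.{w} θ →⋆ₐ[ℂ] B) (hφ : Function.Injective φ) :
    StarSubalgebra.map φ ⊤ = cstarGen {φ (rotU θ), φ (rotV θ)} := by
  have hiso : Isometry φ := NonUnitalStarAlgHom.isometry φ hφ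
  have htop : (StarAlgebra.adjoin ℂ {rotU.{w} θ, rotV.{w} θ}).topologicalClosure = ⊤ :=
    SetLike.coe_injective (dense_adjoin_rot.{w} θ).closure_eq
  rw [← htop, ← StarSubalgebra.topologicalClosure_map _ φ hiso.isClosedEmbedding.isClosedMap
    hiso.continuous, StarAlgHom.map_adjoin, Set.image_pair]
  rfl

end WeightedShiftAlgebra

end

open WeightedShiftAlgebra in
theorem proposition2p6 (θ : ℝ) (hθ : Irrational θ) :
    cstarGen {weightedShift (cosWeight θ)} = cstarGen {shift, diagonal (phase θ)} ∧
    ∃ φ : rotationAlgebra.{w} θ ≃⋆ₐ[ℂ] cstarGen {weightedShift (cosWeight θ)},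
      (φ (rotU θ) : L2Z →L[ℂ] L2Z) = diagonal (phase θ) ∧
      (φ (rotV θ) : L2Z →L[ℂ] L2Z) = shift := by
  refine ⟨cstarGen_weightedShift hθ, ?_⟩
  -- Injectivity needs a nonzero target algebra, hence a nonzero Hilbert space.
  have hnt : Nontrivial L2Z := ⟨e 0, 0, fun h => by
    simpa [e] using congrArg (fun f : L2Z => f 0) h⟩
  obtain ⟨φ, hφU, hφV⟩ := exists_rotationAlgebra_hom.{w} θ (diagonal_phase_mem_unitary θ)
    shift_mem_unitary (diagonal_phase_mul_shift θ)
  have hinj := rotationAlgebra_hom_injective hθ φ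
  have hrange : StarSubalgebra.map φ ⊤ = cstarGen {weightedShift (cosWeight θ)} := by
    rw [map_top_rotationAlgebra φ hinj, hφU, hφV, Set.pair_comm, cstarGen_weightedShift hθ]
  have hmem : ∀ a, φ a ∈ cstarGen {weightedShift (cosWeight θ)} := fun a =>
    hrange ▸ ⟨a, trivial, rfl⟩
  refine ⟨StarAlgEquiv.ofBijective (φ.codRestrict _ hmem) ⟨fun a b hab =>
    hinj (congrArg Subtype.val hab), fun ⟨y, hy⟩ => ?_⟩, hφU, hφV⟩
  rw [← hrange] at hy
  obtain ⟨a, -, rfl⟩ := hy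
  exact ⟨a, rfl⟩
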